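/- Let $G$ be a simple graph, finite or infinite, that is connected, has at least one edge, has all vertex degrees at most $3$, and is not isomorphic to the complete graph $K_4$. Let $L(G)$ be the line graph of $G$ (its vertices are the edges of $G$, and two distinct edges are adjacent if they share an endpoint), and let $\Delta L(G)$ be the clique complex of $L(G)$, that is, the simplicial complex on the edges of $G$ whose simplices are the finite sets of pairwise adjacent vertices of $L(G)$. Then the geometric realization of $\Delta L(G)$ (with the weak topology) is homotopy equivalent to a wedge of circles $\bigvee_{j\in J}\mathbb{S}^1$ for some index set $J$ (possibly empty, in which case the wedge is a point). -/

import Mathlib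

universe u

noncomputable section

/-- The clique complex of a graph `H`: its simplices are the finite nonempty sets of vertices
that induce a complete subgraph. (The empty simplex, which contributes no point to the geometric
realization, is left out of Mathlib's abstract simplicial complexes.) -/
def SimpleGraph.cliqueComplex {W : Type u} (H : SimpleGraph W) : AbstractSimplicialComplex W where
  faces := {s | s.Nonempty ∧ H.IsClique (s : Set W)}
  isRelLowerSet_faces := by
    rintro s ⟨hs, hc⟩
    refine ⟨hs, fun t hts ht => ⟨ht, ?_⟩⟩
    exact hc.subset (Finset.coe_subset.mpr hts)
  singleton_mem := by
    intro v
    refine ⟨Finset.singleton_nonempty v, ?_⟩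
    simp

namespace AbstractSimplicialComplex

/-- The geometric realization of an abstract simplicial complex `K`, as a set: the points are
given by barycentric coordinates, that is, by finitely supported nonnegative functions on the
vertices with sum `1` whose support is a face of `K`. -/
def Realization {W : Type u} (K : AbstractSimplicialComplex W) : Type u :=
  {x : W →₀ ℝ // (∀ w, 0 ≤ x w) ∧ (∑ w ∈ x.support, x w = 1) ∧ x.support ∈ K.faces}

/-- The closed simplex of the geometric realization spanned by a finite set `s` of vertices. -/
def Cell {W : Type u} (K : AbstractSimplicialComplex W) (s : Finset W) : Type u :=
  {x : K.Realization // x.1.support ⊆ s}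

/-- A closed simplex carries its Euclidean topology, that of the barycentric coordinates. -/
instance Cell.instTopologicalSpace {W : Type u} (K : AbstractSimplicialComplex W) (s : Finset W) :
    TopologicalSpace (K.Cell s) :=
  TopologicalSpace.induced (fun x : K.Cell s => fun w : W => x.1.1 w) inferInstance

/-- The topology of the geometric realization is the weak (coherent) one: the finest topology for
which the inclusions of all closed simplices are continuous. So a set is open if and only if it
meets every closed simplex in an open subset of that simplex. -/
instance Realization.instTopologicalSpace {W : Type u} (K : AbstractSimplicialComplex W) :
    TopologicalSpace K.Realization :=
  ⨆ s : K.faces, TopologicalSpace.coinduced (fun x : K.Cell s.1 => x.1) inferInstance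

end AbstractSimplicialComplex

/-- The relation which identifies every base point `p j` with the extra point `*`. -/
inductive WedgeRel {J : Type u} (X : J → Type) (p : ∀ j, X j) :
    (PUnit.{u + 1} ⊕ (Σ j, X j)) → (PUnit.{u + 1} ⊕ (Σ j, X j)) → Prop
  | glue (j : J) : WedgeRel X p (Sum.inl PUnit.unit) (Sum.inr ⟨j, p j⟩)

/-- The wedge of a family of pointed spaces: the quotient of the disjoint union of the spaces and
one point `*` in which all base points are identified with `*`. The empty wedge is a point. -/
def Wedge {J : Type u} (X : J → Type) (p : ∀ j, X j) : Type u :=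
  Quot (WedgeRel X p)

/-- The quotient topology. -/
instance Wedge.instTopologicalSpace {J : Type u} (X : J → Type) [∀ j, TopologicalSpace (X j)]
    (p : ∀ j, X j) : TopologicalSpace (Wedge X p) :=
  inferInstanceAs (TopologicalSpace (Quot (WedgeRel X p)))

/-- The wedge of circles indexed by `J`. -/
abbrev WedgeOfCircles (J : Type u) : Type u :=
  Wedge (fun _ : J => Circle) (fun _ => 1)

end

/-! A clique of a line graph is either a set of edges through one vertex or the three sides of a
triangle. With all degrees at most 3, the complex therefore has dimension at most 2, and its
2-simplices are the stars of the vertices of degree 3 and the triangles of $G$. Both kinds can be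
collapsed.

Since $G$ is connected and not $K_4$, every vertex $v$ of degree 3 has two nonadjacent neighbours
$x, y$ (`exists_isFreeStar`). The 1-simplex $\{vx, vy\}$ lies in no triangle of $G$, so it is a free
face of the star of $v$, and all stars collapse at once. Now two sides of a triangle of $G$ with
common endpoint $a$ form a free face too, because the only other 2-simplex that could contain them,
the star of $a$, is gone. Hence all triangles collapse at once, leaving a connected complex of
dimension at most 1.

Infinitely many collapses can be made simultaneously because each face contains at most one of the
free pairs: the straight-line homotopies do not interfere, and in the weak topology continuity is
checked on one closed simplex at a time (`IsCollapse.nonempty_homotopyEquiv`).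

A connected complex of dimension at most 1 has a spanning tree. Collapsing the tree to a point gives
a wedge with one circle per remaining edge, and this quotient map is a homotopy equivalence because
the tree contracts to its root by a homotopy of the whole complex
(`SpanningTree.nonempty_homotopyEquiv`). -/

open scoped unitInterval

/-! ### Continuity into and out of geometric realizations -/

namespace AbstractSimplicialComplex

variable {W : Type u} {K L : AbstractSimplicialComplex W}

theorem mem_faces_of_subset {s t : Finset W} (hs : s ∈ K.faces) (hts : t ⊆ s)
    (ht : t.Nonempty) : t ∈ K.faces :=
  (K.isRelLowerSet_faces hs).2 hts ht

namespace Realization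

/-- A map out of the realization is continuous if it is so on every closed simplex. -/
theorem continuous_of_cells {Y : Type*} [TopologicalSpace Y] {f : K.Realization → Y}
    (h : ∀ s ∈ K.faces, Continuous fun x : K.Cell s => f x.1) : Continuous f := by
  refine continuous_iSup_dom.2 fun s => continuous_coinduced_dom.2 ?_
  exact h s.1 s.2

theorem continuous_cell_val {s : Finset W} (hs : s ∈ K.faces) :
    Continuous fun x : K.Cell s => x.1 := by
  refine continuous_iSup_rng (i := (⟨s, hs⟩ : K.faces)) ?_
  exact continuous_coinduced_rng

theorem _root_.AbstractSimplicialComplex.Cell.continuous_coord {s : Finset W} (w : W) :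
    Continuous fun x : K.Cell s => x.1.1 w :=
  (continuous_apply w).comp continuous_induced_dom

/-- A map into finitely many simplices of the realization is continuous if its barycentric
coordinates are. -/
theorem continuous_of_support_subset {Y : Type*} [TopologicalSpace Y] {f : Y → K.Realization}
    (s : Finset W) (hs : ∀ y, (f y).1.support ⊆ s) (hf : ∀ w, Continuous fun y => (f y).1 w) :
    Continuous f := by
  classical
  let ι := {t : Finset W // t ∈ s.powerset ∧ t ∈ K.faces}
  have : Finite ι := Set.Finite.to_subtype
    ((Finset.finite_toSet s.powerset).subset fun t ht => ht.1)
  let C : ι → Set Y := fun t => {y | (f y).1.support ⊆ t.1}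
  -- The faces inside `s` give a finite closed cover of the source; `s` itself need not be a face.
  refine (locallyFinite_of_finite C).continuous ?_ ?_ ?_
  · refine Set.eq_univ_of_forall fun y => Set.mem_iUnion.2
      ⟨⟨(f y).1.support, Finset.mem_powerset.2 (hs y), (f y).2.2.2⟩, ?_⟩
    exact Finset.Subset.refl _
  · intro t
    have : C t = ⋂ w ∈ {w | w ∉ t.1}, {y | (f y).1 w = 0} := by
      ext y
      simp only [C, Set.mem_ofPred_eq, Set.mem_iInter, Finset.subset_iff, Finsupp.mem_support_iff]
      exact ⟨fun h w hw => by_contra fun h' => hw (h h'), fun h w hw => by_contra fun h' => hw (h w h')⟩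
    rw [this]
    exact isClosed_biInter fun w _ => isClosed_eq (hf w) continuous_const
  · intro t
    rw [continuousOn_iff_continuous_domRestrict]
    have hp : Continuous fun (y : C t) w => (f y.1).1 w :=
      continuous_pi fun w => (hf w).comp continuous_subtype_val
    let F : C t → K.Cell t.1 := fun y => ⟨f y.1, y.2⟩
    have hF : Continuous F := continuous_induced_rng.2 hp
    exact (continuous_cell_val t.2.2).comp hF

/-- A point given by barycentric coordinates supported in a face. -/
def mk (x : W →₀ ℝ) (h0 : ∀ w, 0 ≤ x w) (h1 : x.degree = 1) {s : Finset W} (hs : s ∈ K.faces)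
    (hxs : x.support ⊆ s) : K.Realization :=
  ⟨x, h0, h1, mem_faces_of_subset hs hxs (by
    rw [Finset.nonempty_iff_ne_empty]
    intro h
    rw [Finsupp.support_eq_empty.1 h] at h1
    simp at h1)⟩

theorem degree_eq_one (x : K.Realization) : x.1.degree = 1 := x.2.2.1

theorem mem_support (x : K.Realization) (w : W) : w ∈ x.1.support ↔ 0 < x.1 w := by
  rw [Finsupp.mem_support_iff]
  exact ⟨fun h => lt_of_le_of_ne (x.2.1 w) h.symm, fun h => h.ne'⟩

end Realization

/-! ### Simultaneous collapses through free edges -/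

/-- Move barycentric weight symmetrically from `p` and `q` to `r`. -/
noncomputable def push (p q r : W) (t : ℝ) (x : W →₀ ℝ) : W →₀ ℝ :=
  x - Finsupp.single p (t * min (x p) (x q)) - Finsupp.single q (t * min (x p) (x q))
    + Finsupp.single r (2 * (t * min (x p) (x q)))

section push
variable {p q r : W} (t : ℝ) (x : W →₀ ℝ)

theorem push_left (hpq : p ≠ q) (hpr : p ≠ r) :
    push p q r t x p = x p - t * min (x p) (x q) := by
  simp [push, hpq, hpr]

theorem push_right (hpq : p ≠ q) (hqr : q ≠ r) :
    push p q r t x q = x q - t * min (x p) (x q) := by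
  simp [push, hpq, hqr]

theorem push_apex (hpr : p ≠ r) (hqr : q ≠ r) :
    push p q r t x r = x r + 2 * (t * min (x p) (x q)) := by
  simp [push, hpr.symm, hqr.symm]

theorem push_of_ne {w : W} (hp : w ≠ p) (hq : w ≠ q) (hr : w ≠ r) : push p q r t x w = x w := by
  simp [push, hp, hq, hr]

theorem degree_push : (push p q r t x).degree = x.degree := by
  simp only [push, map_add, map_sub, Finsupp.degree_single]
  ring

theorem push_of_min_eq_zero (h : min (x p) (x q) = 0) : push p q r t x = x := by
  simp [push, h]

theorem push_nonneg (hpq : p ≠ q) (hpr : p ≠ r) (hqr : q ≠ r) (ht : t ∈ I) (hx : ∀ w, 0 ≤ x w)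
    (w : W) : 0 ≤ push p q r t x w := by
  have hm : 0 ≤ min (x p) (x q) := le_min (hx p) (hx q)
  have h1 : t * min (x p) (x q) ≤ min (x p) (x q) := mul_le_of_le_one_left hm ht.2
  have h2 : 0 ≤ t * min (x p) (x q) := mul_nonneg ht.1 hm
  by_cases hp : w = p
  · subst hp
    rw [push_left t x hpq hpr]
    linarith [min_le_left (x w) (x q)]
  by_cases hq : w = q
  · subst hq
    rw [push_right t x hpq hqr]
    linarith [min_le_right (x p) (x w)]
  by_cases hr : w = r
  · subst hr
    rw [push_apex t x hpr hqr]
    linarith [hx w]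
  · rw [push_of_ne t x hp hq hr]
    exact hx w

theorem continuous_push (w : W) {Y : Type*} [TopologicalSpace Y] {T : Y → ℝ} {X : Y → W →₀ ℝ}
    (hT : Continuous T) (hX : ∀ w, Continuous fun y => X y w) :
    Continuous fun y => push p q r (T y) (X y) w := by
  classical
  have hm : Continuous fun y => T y * min (X y p) (X y q) := hT.mul ((hX p).min (hX q))
  have hs : ∀ (v : W) {g : Y → ℝ}, Continuous g → Continuous fun y => Finsupp.single v (g y) w := by
    intro v g hg
    simp only [Finsupp.single_apply]
    split_ifs
    · exact hg
    · exact continuous_const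
  simp only [push, Finsupp.add_apply, Finsupp.sub_apply]
  exact (((hX w).sub (hs p hm)).sub (hs q hm)).add (hs r (continuous_const.mul hm))

end push

/-- `L` arises from `K` by removing, for each `i`, a triangle `{p i, q i, r i}` together with its
edge `{p i, q i}`, which is a face of no other triangle. -/
structure IsCollapse (K L : AbstractSimplicialComplex W) {ι : Type*} (p q r : ι → W) : Prop where
  ne_pq : ∀ i, p i ≠ q i
  ne_pr : ∀ i, p i ≠ r i
  ne_qr : ∀ i, q i ≠ r i
  face : ∀ i, ∃ s ∈ K.faces, p i ∈ s ∧ q i ∈ s ∧ r i ∈ s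
  free : ∀ i, ∀ s ∈ K.faces, p i ∈ s → q i ∈ s → ∀ w ∈ s, w = p i ∨ w = q i ∨ w = r i
  inj : ∀ i j, ∀ s ∈ K.faces, p i ∈ s → q i ∈ s → p j ∈ s → q j ∈ s → i = j
  mem_iff : ∀ s, s ∈ L.faces ↔ s ∈ K.faces ∧ ∀ i, ¬ (p i ∈ s ∧ q i ∈ s)

namespace IsCollapse

variable {ι : Type*} {p q r : ι → W} (h : IsCollapse K L p q r)
include h

/-- The first clause ranges over all faces around the support, so that a single formula holds on a
whole closed simplex. Where the pair is not in the support, the minimum is 0 and nothing moves;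
`inj` makes the choice of `i` unambiguous. -/
theorem exists_push (x : K.Realization) (t : I) : ∃ y : K.Realization,
    (∀ i, ∀ s ∈ K.faces, x.1.support ⊆ s → p i ∈ s → q i ∈ s →
      y.1 = push (p i) (q i) (r i) t x.1) ∧
    ((∀ i, ¬ (p i ∈ x.1.support ∧ q i ∈ x.1.support)) → y = x) := by
  classical
  by_cases hx : ∃ i, p i ∈ x.1.support ∧ q i ∈ x.1.support
  · obtain ⟨i, hp, hq⟩ := hx
    obtain ⟨s, hs, hps, hqs, hrs⟩ := h.face i
    refine ⟨Realization.mk (push (p i) (q i) (r i) t x.1)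
      (push_nonneg _ _ (h.ne_pq i) (h.ne_pr i) (h.ne_qr i) t.2 x.2.1)
      ((degree_push _ _).trans x.degree_eq_one) hs ?_, ?_, fun hn => (hn i ⟨hp, hq⟩).elim⟩
    · intro w hw
      by_contra hws
      have h1 : w ≠ p i := fun e => hws (e ▸ hps)
      have h2 : w ≠ q i := fun e => hws (e ▸ hqs)
      have h3 : w ≠ r i := fun e => hws (e ▸ hrs)
      rw [Finsupp.mem_support_iff, push_of_ne _ _ h1 h2 h3, ← Finsupp.mem_support_iff] at hw
      rcases h.free i _ x.2.2.2 hp hq w hw with e | e | e <;> contradiction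
    · intro j s' hs' hxs hpj hqj
      obtain rfl := h.inj i j s' hs' (hxs hp) (hxs hq) hpj hqj
      rfl
  · push Not at hx
    refine ⟨x, fun i s hs hxs hp hq => (push_of_min_eq_zero _ _ ?_).symm, fun _ => rfl⟩
    by_cases hp : p i ∈ x.1.support
    · have : x.1 (q i) = 0 := by simpa using hx i hp
      rw [this, min_eq_right (x.2.1 _)]
    · have : x.1 (p i) = 0 := by simpa using hp
      rw [this, min_eq_left (x.2.1 _)]

/-- The straight line homotopy that performs all the collapses. -/
noncomputable def slide (x : K.Realization) (t : I) : K.Realization := (h.exists_push x t).choose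

theorem slide_eq_push {x : K.Realization} {t : I} {i : ι} {s : Finset W} (hs : s ∈ K.faces)
    (hx : x.1.support ⊆ s) (hp : p i ∈ s) (hq : q i ∈ s) :
    (h.slide x t).1 = push (p i) (q i) (r i) t x.1 :=
  (h.exists_push x t).choose_spec.1 i s hs hx hp hq

theorem slide_eq_self {x : K.Realization} {t : I}
    (hx : ∀ i, ¬ (p i ∈ x.1.support ∧ q i ∈ x.1.support)) : h.slide x t = x :=
  (h.exists_push x t).choose_spec.2 hx

theorem slide_zero (x : K.Realization) : h.slide x 0 = x := by
  by_cases hx : ∃ i, p i ∈ x.1.support ∧ q i ∈ x.1.support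
  · obtain ⟨i, hp, hq⟩ := hx
    refine Subtype.ext ?_
    rw [h.slide_eq_push x.2.2.2 (Finset.Subset.refl _) hp hq]
    simp [push]
  · exact h.slide_eq_self (by simpa using hx)

/-- At time 1 the smaller of the two weights is used up, which removes the pair `i`; by `inj` the
triangle contains no other pair. -/
theorem slide_one_mem (x : K.Realization) : (h.slide x 1).1.support ∈ L.faces := by
  refine (h.mem_iff _).2 ⟨(h.slide x 1).2.2.2, ?_⟩
  by_cases hx : ∃ i, p i ∈ x.1.support ∧ q i ∈ x.1.support
  · obtain ⟨i, hp, hq⟩ := hx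
    have e := h.slide_eq_push (t := 1) x.2.2.2 (Finset.Subset.refl _) hp hq
    intro j hj
    obtain ⟨s, hs, hps, hqs, hrs⟩ := h.face i
    have hsub : (h.slide x 1).1.support ⊆ s := by
      intro w hw
      by_contra hws
      have h1 : w ≠ p i := fun e => hws (e ▸ hps)
      have h2 : w ≠ q i := fun e => hws (e ▸ hqs)
      have h3 : w ≠ r i := fun e => hws (e ▸ hrs)
      rw [Finsupp.mem_support_iff, e, push_of_ne _ _ h1 h2 h3, ← Finsupp.mem_support_iff] at hw
      rcases h.free i _ x.2.2.2 hp hq w hw with e | e | e <;> contradiction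
    obtain rfl := h.inj j i s hs (hsub hj.1) (hsub hj.2) hps hqs
    rw [Finsupp.mem_support_iff, Finsupp.mem_support_iff, e, push_left _ _ (h.ne_pq j) (h.ne_pr j),
      push_right _ _ (h.ne_pq j) (h.ne_qr j)] at hj
    rcases le_total (x.1 (p j)) (x.1 (q j)) with hle | hle
    · exact hj.1 (by simp [hle])
    · exact hj.2 (by simp [hle])
  · push Not at hx
    rw [h.slide_eq_self (by simpa using hx)]
    simpa using hx

/-- The parameter space and the target complex are left free so that the retraction onto `L`, the
single trajectories and the homotopy are all instances. -/
theorem continuous_slide {Y : Type*} [TopologicalSpace Y] {s : Finset W} (hs : s ∈ K.faces)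
    {T : Y → I} {X : Y → K.Cell s} (hT : Continuous T) (hX : Continuous X) {M : AbstractSimplicialComplex W}
    {f : Y → M.Realization} (hf : ∀ y, (f y).1 = (h.slide (X y).1 (T y)).1) : Continuous f := by
  classical
  have hX' : ∀ w, Continuous fun y => (X y).1.1 w := fun w => (Cell.continuous_coord w).comp hX
  by_cases hi : ∃ i, p i ∈ s ∧ q i ∈ s
  · obtain ⟨i, hp, hq⟩ := hi
    have hf' : ∀ y, (f y).1 = push (p i) (q i) (r i) (T y) (X y).1.1 := fun y =>
      (hf y).trans (h.slide_eq_push hs (X y).2 hp hq)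
    refine Realization.continuous_of_support_subset (insert (r i) s) (fun y w hw => ?_) fun w => ?_
    · by_contra hws
      rw [Finset.mem_insert, not_or] at hws
      have h1 : w ≠ p i := fun e => hws.2 (e ▸ hp)
      have h2 : w ≠ q i := fun e => hws.2 (e ▸ hq)
      rw [hf', Finsupp.mem_support_iff, push_of_ne _ _ h1 h2 hws.1, ← Finsupp.mem_support_iff] at hw
      exact hws.2 ((X y).2 hw)
    · simp only [hf']
      exact continuous_push w (continuous_subtype_val.comp hT) hX'
  · push Not at hi
    have hf' : ∀ y, (f y).1 = (X y).1.1 := fun y => by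
      rw [hf, h.slide_eq_self fun i hpq => hi i ((X y).2 hpq.1) ((X y).2 hpq.2)]
    refine Realization.continuous_of_support_subset s (fun y => ?_) fun w => ?_
    · rw [hf']; exact (X y).2
    · simp only [hf']; exact hX' w

/-- Collapsing triangles through free edges does not change the homotopy type. -/
theorem nonempty_homotopyEquiv :
    Nonempty (ContinuousMap.HomotopyEquiv K.Realization L.Realization) := by
  let ρ : C(K.Realization, L.Realization) :=
    ⟨fun x => ⟨(h.slide x 1).1, (h.slide x 1).2.1, (h.slide x 1).2.2.1, h.slide_one_mem x⟩,
      Realization.continuous_of_cells fun s hs =>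
        h.continuous_slide hs (T := fun _ => 1) continuous_const continuous_id fun _ => rfl⟩
  let inc : C(L.Realization, K.Realization) :=
    ⟨fun x => ⟨x.1, x.2.1, x.2.2.1, ((h.mem_iff _).1 x.2.2.2).1⟩,
      Realization.continuous_of_cells fun s _ => Realization.continuous_of_support_subset s
        (fun x => x.2) fun w => Cell.continuous_coord w⟩
  have hslice : ∀ x, Continuous (h.slide x) := fun x =>
    h.continuous_slide (f := h.slide x) x.2.2.2 (T := id)
      (X := fun _ => ⟨x, Finset.Subset.refl _⟩) continuous_id continuous_const fun _ => rfl
  -- The homotopy is curried: continuity out of the realization can be tested on cells, and no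
  -- topology on the product with `I` has to be compared.
  let S : C(K.Realization, C(I, K.Realization)) :=
    ⟨fun x => ⟨h.slide x, hslice x⟩, Realization.continuous_of_cells fun s hs =>
      ContinuousMap.continuous_of_continuous_uncurry _
        (h.continuous_slide hs (T := Prod.snd) (X := Prod.fst) continuous_snd continuous_fst
          fun _ => rfl)⟩
  have hleft : (inc.comp ρ).Homotopic (ContinuousMap.id _) := by
    refine ContinuousMap.Homotopic.symm ⟨⟨S.uncurry.comp ⟨Prod.swap, continuous_swap⟩, ?_, ?_⟩⟩
    · exact h.slide_zero
    · intro x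
      rfl
  have hright : ρ.comp inc = ContinuousMap.id _ := by
    ext x
    refine Subtype.ext ?_
    change (h.slide (inc x) 1).1 = x.1
    rw [h.slide_eq_self (x := inc x) ((h.mem_iff _).1 x.2.2.2).2]
    rfl
  exact ⟨⟨ρ, inc, hleft, hright ▸ ContinuousMap.Homotopic.refl _⟩⟩

end IsCollapse

end AbstractSimplicialComplex

/-! ### Quotient maps that are homotopy equivalences -/

/-- A quotient map is a homotopy equivalence if the identity is homotopic, by a homotopy that is
compatible with the quotient map, to a map that factors through it. -/
theorem Topology.IsQuotientMap.nonempty_homotopyEquiv {X Y : Type*} [TopologicalSpace X]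
    [TopologicalSpace Y] {f : C(X, Y)} (hf : Topology.IsQuotientMap f) (H : C(X, C(I, X)))
    (h0 : ∀ x, H x 0 = x) (h1 : ∀ x y, f x = f y → H x 1 = H y 1)
    (ht : ∀ x y, f x = f y → ∀ t, f (H x t) = f (H y t)) :
    Nonempty (ContinuousMap.HomotopyEquiv X Y) := by
  let k : C(X, X) := ⟨fun x => H x 1, (continuous_eval_const (1 : I)).comp H.continuous⟩
  let fH : C(X, C(I, Y)) := ⟨fun x => f.comp (H x), (ContinuousMap.continuous_postcomp f).comp H.continuous⟩
  let g : C(Y, X) := hf.lift k h1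
  have hg : ∀ x, g (f x) = H x 1 := fun x => DFunLike.congr_fun (hf.lift_comp k h1) x
  have hfH : Function.FactorsThrough fH f := fun x y e => ContinuousMap.ext fun t => ht x y e t
  -- Currying lets the homotopy descend by the universal property of `f` alone, without asking
  -- whether `f × id` is a quotient map.
  let G : C(Y, C(I, Y)) := hf.lift fH hfH
  have hG : ∀ x t, G (f x) t = f (H x t) := fun x t =>
    DFunLike.congr_fun (DFunLike.congr_fun (hf.lift_comp fH hfH) x) t
  refine ⟨⟨f, g, ContinuousMap.Homotopic.symm
    ⟨⟨H.uncurry.comp ⟨Prod.swap, continuous_swap⟩, h0, fun x => (hg x).symm⟩⟩,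
    ContinuousMap.Homotopic.symm ⟨⟨G.uncurry.comp ⟨Prod.swap, continuous_swap⟩, ?_, ?_⟩⟩⟩⟩
  · intro y
    obtain ⟨x, rfl⟩ := hf.surjective y
    exact (hG x 0).trans (congrArg f (h0 x))
  · intro y
    obtain ⟨x, rfl⟩ := hf.surjective y
    exact (hG x 1).trans (congrArg f (hg x).symm)

/-! ### Connectedness under collapse, and complexes of dimension at most one -/

namespace AbstractSimplicialComplex

variable {W : Type u} (K : AbstractSimplicialComplex W)

/-- Two vertices lie in a common face. -/
def Joined (u v : W) : Prop := ∃ s ∈ K.faces, u ∈ s ∧ v ∈ s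

/-- The graph formed by the vertices and edges of a simplicial complex. -/
def skeletonGraph : SimpleGraph W where
  Adj u v := u ≠ v ∧ K.Joined u v
  symm := ⟨fun _ _ h => ⟨h.1.symm, let ⟨s, hs, hu, hv⟩ := h.2; ⟨s, hs, hv, hu⟩⟩⟩
  loopless := ⟨fun _ h => h.1 rfl⟩

variable {K}

/-- A deleted edge from `p i` to `q i` is replaced by the detour through `r i`. -/
theorem IsCollapse.connected {L : AbstractSimplicialComplex W} {ι : Type*} {p q r : ι → W}
    (h : IsCollapse K L p q r) (hK : K.skeletonGraph.Connected) : L.skeletonGraph.Connected := by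
  classical
  -- The other two sides of the triangle survive: by `inj` the only pair in the triangle is the pair
  -- `i`, and neither side contains it.
  have key : ∀ i (a : W), (a = p i ∨ a = q i) → L.skeletonGraph.Adj a (r i) := by
    intro i a ha
    obtain ⟨s, hs, hp, hq, hr⟩ := h.face i
    have has : a ∈ s := by rcases ha with rfl | rfl <;> assumption
    refine ⟨?_, {a, r i}, (h.mem_iff _).2 ⟨mem_faces_of_subset hs ?_ (by simp), ?_⟩, by simp,
      by simp⟩
    · rcases ha with rfl | rfl
      exacts [h.ne_pr i, h.ne_qr i]
    · intro w hw
      rcases Finset.mem_insert.1 hw with rfl | hw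
      · exact has
      · exact Finset.mem_singleton.1 hw ▸ hr
    · intro j ⟨h1, h2⟩
      have hsub : ∀ w ∈ ({a, r i} : Finset W), w ∈ s := by
        intro w hw
        rcases Finset.mem_insert.1 hw with rfl | hw
        · exact has
        · exact Finset.mem_singleton.1 hw ▸ hr
      obtain rfl := h.inj i j s hs hp hq (hsub _ h1) (hsub _ h2)
      have n1 := h.ne_pr i
      have n2 := h.ne_qr i
      have n3 := h.ne_pq i
      simp only [Finset.mem_insert, Finset.mem_singleton] at h1 h2
      grind
  have step : ∀ u v, K.skeletonGraph.Adj u v → L.skeletonGraph.Reachable u v := by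
    intro u v ⟨huv, s, hs, hu, hv⟩
    have hsub : ({u, v} : Finset W) ⊆ s := by
      intro w hw
      rcases Finset.mem_insert.1 hw with rfl | hw
      · exact hu
      · exact Finset.mem_singleton.1 hw ▸ hv
    by_cases hi : ∃ i, p i ∈ ({u, v} : Finset W) ∧ q i ∈ ({u, v} : Finset W)
    · obtain ⟨i, h1, h2⟩ := hi
      have n3 := h.ne_pq i
      have : (u = p i ∨ u = q i) ∧ (v = p i ∨ v = q i) := by
        simp only [Finset.mem_insert, Finset.mem_singleton] at h1 h2
        grind
      exact (key i u this.1).reachable.trans (key i v this.2).reachable.symm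
    · push Not at hi
      refine SimpleGraph.Adj.reachable ⟨huv, {u, v}, (h.mem_iff _).2
        ⟨mem_faces_of_subset hs hsub (by simp), ?_⟩, by simp, by simp⟩
      intro i hpq
      exact hi i hpq.1 hpq.2
  have := hK.nonempty
  refine ⟨fun u v => ?_⟩
  obtain ⟨w⟩ := hK.preconnected u v
  induction w with
  | nil => exact .refl _
  | cons hadj _ ih => exact (step _ _ hadj).trans ih

namespace Realization

/-- The point of the edge `{u, v}` at parameter `s`, clamped to `[0, 1]`. -/
noncomputable def edgePt {u v : W} (huv : K.Joined u v) (s : ℝ) : K.Realization := by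
  classical
  exact mk (Finsupp.single u (1 - (Set.projIcc (0 : ℝ) 1 zero_le_one s : ℝ)) +
      Finsupp.single v (Set.projIcc (0 : ℝ) 1 zero_le_one s : ℝ))
    (fun w => by
      have h := (Set.projIcc (0 : ℝ) 1 zero_le_one s).2
      rw [Finsupp.add_apply, Finsupp.single_apply, Finsupp.single_apply]
      have := h.1
      have := h.2
      split_ifs <;> linarith)
    (by rw [map_add, Finsupp.degree_single, Finsupp.degree_single]; ring)
    huv.choose_spec.1
    (by
      refine Finsupp.support_add.trans (Finset.union_subset ?_ ?_)
      · exact Finsupp.support_single_subset.trans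
          (Finset.singleton_subset_iff.2 huv.choose_spec.2.1)
      · exact Finsupp.support_single_subset.trans
          (Finset.singleton_subset_iff.2 huv.choose_spec.2.2))

theorem edgePt_val {u v : W} (huv : K.Joined u v) {s : ℝ} (hs : s ∈ I) :
    (edgePt huv s).1 = Finsupp.single u (1 - s) + Finsupp.single v s := by
  simp [edgePt, mk, Set.projIcc_of_mem _ hs]

theorem continuous_edgePt {u v : W} (huv : K.Joined u v) : Continuous (edgePt huv) := by
  classical
  refine continuous_of_support_subset {u, v} (fun y => ?_) fun w => ?_
  · refine Finsupp.support_add.trans (Finset.union_subset ?_ ?_) <;>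
      refine Finsupp.support_single_subset.trans ?_ <;> simp
  · simp only [edgePt, mk, Finsupp.add_apply, Finsupp.single_apply]
    refine Continuous.add ?_ ?_ <;> split_ifs <;> fun_prop

theorem _root_.AbstractSimplicialComplex.joined_self (v : W) : K.Joined v v :=
  ⟨{v}, K.singleton_mem v, by simp, by simp⟩

/-- A vertex as a point of the realization. -/
noncomputable def vert (K : AbstractSimplicialComplex W) (v : W) : K.Realization :=
  edgePt (joined_self v) 0

theorem vert_val (v : W) : (vert K v).1 = Finsupp.single v 1 := by
  simp [vert, edgePt_val _ unitInterval.zero_mem]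

theorem vert_injective : Function.Injective (vert K) := fun u v h => by
  have := congrArg Subtype.val h
  rw [vert_val, vert_val] at this
  exact (Finsupp.single_left_inj one_ne_zero).1 this

theorem edgePt_zero {u v : W} (huv : K.Joined u v) : edgePt huv 0 = vert K u := by
  refine Subtype.ext ?_
  simp [vert_val, edgePt_val _ unitInterval.zero_mem]

theorem edgePt_one {u v : W} (huv : K.Joined u v) : edgePt huv 1 = vert K v := by
  refine Subtype.ext ?_
  simp [vert_val, edgePt_val _ unitInterval.one_mem]

theorem edgePt_of_one_le {u v : W} (huv : K.Joined u v) {s : ℝ} (hs : 1 ≤ s) :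
    edgePt huv s = vert K v := by
  rw [← edgePt_one huv]
  simp [edgePt, Set.projIcc_of_right_le _ hs]

theorem support_edgePt [DecidableEq W] {u v : W} (huv : K.Joined u v) (hne : u ≠ v) {s : ℝ}
    (hs : s ∈ Set.Ioo (0 : ℝ) 1) : (edgePt huv s).1.support = {u, v} := by
  ext w
  rw [edgePt_val _ (Set.Ioo_subset_Icc_self hs), Finsupp.mem_support_iff, Finsupp.add_apply,
    Finsupp.single_apply, Finsupp.single_apply, Finset.mem_insert, Finset.mem_singleton]
  have h1 := hs.1
  have h2 := hs.2
  grind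

theorem edgePt_coord {u v : W} (huv : K.Joined u v) (hne : u ≠ v) {s : ℝ} (hs : s ∈ I) :
    (edgePt huv s).1 v = s := by
  rw [edgePt_val _ hs]
  simp [hne]

theorem eq_edgePt_of_support_subset [DecidableEq W] {u v : W} (huv : K.Joined u v) (hne : u ≠ v)
    {x : K.Realization} (hx : x.1.support ⊆ {u, v}) : x.1 v ∈ I ∧ x = edgePt huv (x.1 v) := by
  have hsum : x.1 u + x.1 v = 1 := by
    refine Eq.trans ?_ x.degree_eq_one
    rw [Finsupp.degree_apply, Finset.sum_subset hx, Finset.sum_pair hne]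
    intro w _ hw
    simpa using hw
  have hI : x.1 v ∈ I := ⟨x.2.1 v, by linarith [x.2.1 u]⟩
  refine ⟨hI, Subtype.ext ?_⟩
  rw [edgePt_val _ hI]
  ext w
  rw [Finsupp.add_apply, Finsupp.single_apply, Finsupp.single_apply]
  by_cases hu : u = w
  · subst hu
    rw [if_pos rfl, if_neg hne.symm]
    linarith
  by_cases hv : v = w
  · subst hv
    simp [hu]
  · have : w ∉ x.1.support := fun h => by
      have := hx h
      grind
    simpa [hu, hv] using this

theorem eq_vert_of_support_subset {v : W} {x : K.Realization} (hx : x.1.support ⊆ {v}) :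
    x = vert K v := by
  refine Subtype.ext ?_
  rw [vert_val]
  have hsum : x.1 v = 1 := by
    refine Eq.trans ?_ x.degree_eq_one
    rw [Finsupp.degree_apply, Finset.sum_subset hx, Finset.sum_singleton]
    intro w _ hw
    simpa using hw
  exact (Finsupp.support_subset_singleton.1 hx).trans (congrArg (Finsupp.single v) hsum)

end Realization

/-- An orientation of the edges of a simplicial complex of dimension at most one. -/
structure IsOrientation (K : AbstractSimplicialComplex W) (D : W → W → Prop) : Prop where
  joined : ∀ u v, D u v → K.Joined u v
  asymm : ∀ u v, D u v → ¬ D v u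
  total : ∀ u v, K.Joined u v → u ≠ v → D u v ∨ D v u

theorem IsOrientation.ne {D : W → W → Prop} (hD : IsOrientation K D) {u v : W} (h : D u v) :
    u ≠ v := fun e => hD.asymm u v h (e ▸ h : D v u)

-- A support has one or two elements. The open parameter interval keeps the two cases disjoint.
open Realization in
theorem IsOrientation.cases {D : W → W → Prop} (hD : IsOrientation K D)
    (hdim : ∀ s ∈ K.faces, s.card ≤ 2) (x : K.Realization) :
    (∃ v, x = vert K v) ∨ ∃ u v, ∃ h : D u v, ∃ s ∈ Set.Ioo (0 : ℝ) 1,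
      x = edgePt (hD.joined u v h) s := by
  classical
  have hface := x.2.2.2
  have hpos := (K.isRelLowerSet_faces hface).1.card_pos
  have hcard := hdim _ hface
  interval_cases hc : x.1.support.card
  · obtain ⟨v, hv⟩ := Finset.card_eq_one.1 hc
    exact Or.inl ⟨v, eq_vert_of_support_subset hv.subset⟩
  · obtain ⟨a, b, hab, hx⟩ := Finset.card_eq_two.1 hc
    have main : ∀ u v, x.1.support = {u, v} → D u v → ∃ u v, ∃ h : D u v,
        ∃ s ∈ Set.Ioo (0 : ℝ) 1, x = edgePt (hD.joined u v h) s := by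
      intro u v hx h
      obtain ⟨hI, he⟩ := eq_edgePt_of_support_subset (hD.joined u v h) (hD.ne h) hx.subset
      have hv : 0 < x.1 v := (x.mem_support v).1 (by simp [hx])
      have hu : 0 < x.1 u := (x.mem_support u).1 (by simp [hx])
      refine ⟨u, v, h, x.1 v, ⟨hv, lt_of_le_of_ne hI.2 fun e => ?_⟩, he⟩
      rw [he, e, edgePt_one, vert_val, Finsupp.single_apply, if_neg (hD.ne h).symm] at hu
      exact hu.false
    refine Or.inr ?_
    rcases hD.total a b ⟨_, hface, by simp [hx], by simp [hx]⟩ hab with h | h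
    · exact main a b hx h
    · exact main b a (hx.trans (Finset.pair_comm a b)) h

open Realization in
/-- A map out of a one-dimensional complex is given by the images of the vertices and by paths
between them along the edges. -/
theorem IsOrientation.exists_lift {D : W → W → Prop} (hD : IsOrientation K D)
    (hdim : ∀ s ∈ K.faces, s.card ≤ 2) {Y : Type*} [TopologicalSpace Y] (c : W → Y)
    (φ : W → W → ℝ → Y) (hφ : ∀ u v, D u v → Continuous (φ u v))
    (h0 : ∀ u v, D u v → φ u v 0 = c u) (h1 : ∀ u v, D u v → φ u v 1 = c v) :
    ∃ F : C(K.Realization, Y), (∀ v, F (vert K v) = c v) ∧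
      ∀ u v, ∀ h : D u v, ∀ s ∈ I, F (edgePt (hD.joined u v h) s) = φ u v s := by
  classical
  have key : ∀ x : K.Realization, ∃ y : Y, (∀ v, x = vert K v → y = c v) ∧
      ∀ u v, ∀ h : D u v, ∀ s ∈ I, x = edgePt (hD.joined u v h) s → y = φ u v s := by
    intro x
    rcases hD.cases hdim x with ⟨w, rfl⟩ | ⟨a, b, hab, s, hs, rfl⟩
    · refine ⟨c w, fun v hv => congrArg c (vert_injective hv), fun u v h s hs he => ?_⟩
      rcases hs.1.eq_or_lt with rfl | hs0
      · rw [edgePt_zero] at he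
        rw [h0 u v h, vert_injective he]
      rcases hs.2.eq_or_lt with rfl | hs1
      · rw [edgePt_one] at he
        rw [h1 u v h, vert_injective he]
      have hsupp := support_edgePt (hD.joined u v h) (hD.ne h) ⟨hs0, hs1⟩
      rw [← he, vert_val, Finsupp.support_single _ one_ne_zero] at hsupp
      have := congrArg Finset.card hsupp
      rw [Finset.card_singleton, Finset.card_pair (hD.ne h)] at this
      omega
    · have hsupp := support_edgePt (hD.joined a b hab) (hD.ne hab) hs
      refine ⟨φ a b s, fun v hv => ?_, fun u v h s' hs' he => ?_⟩
      · rw [hv, vert_val, Finsupp.support_single _ one_ne_zero] at hsupp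
        have := congrArg Finset.card hsupp
        rw [Finset.card_singleton, Finset.card_pair (hD.ne hab)] at this
        omega
      -- An interior point determines its edge through its support, asymmetry of `D` fixes the
      -- direction, and the coordinate at `b` recovers the parameter.
      · have hsub : ({a, b} : Finset W) ⊆ {u, v} := by
          rw [← hsupp, he]
          intro w hw
          rw [Finsupp.mem_support_iff, edgePt_val _ hs', Finsupp.add_apply, Finsupp.single_apply,
            Finsupp.single_apply] at hw
          grind
        have ha : a ∈ ({u, v} : Finset W) := hsub (by simp)
        have hb : b ∈ ({u, v} : Finset W) := hsub (by simp)
        have hne := hD.ne hab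
        have hasymm := hD.asymm u v h
        obtain ⟨rfl, rfl⟩ : a = u ∧ b = v := by
          simp only [Finset.mem_insert, Finset.mem_singleton] at ha hb
          rcases ha with rfl | rfl <;> rcases hb with rfl | rfl
          · exact (hne rfl).elim
          · exact ⟨rfl, rfl⟩
          · exact (hasymm hab).elim
          · exact (hne rfl).elim
        have := congrArg (fun x : K.Realization => x.1 b) he
        simp only [edgePt_coord _ hne hs', edgePt_coord _ hne (Set.Ioo_subset_Icc_self hs)] at this
        rw [this]
  choose F hF1 hF2 using key
  refine ⟨⟨F, continuous_of_cells fun s hs => ?_⟩, fun v => hF1 _ v rfl,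
    fun u v h s hs => hF2 _ u v h s hs rfl⟩
  have hpos := (K.isRelLowerSet_faces hs).1.card_pos
  have hcard := hdim _ hs
  interval_cases hc : s.card
  · obtain ⟨v, rfl⟩ := Finset.card_eq_one.1 hc
    have : (fun x : K.Cell {v} => F x.1) = fun _ => c v :=
      funext fun x => hF1 _ v (eq_vert_of_support_subset x.2)
    rw [this]
    exact continuous_const
  · obtain ⟨a, b, hab, hs'⟩ := Finset.card_eq_two.1 hc
    have main : ∀ u v, s = {u, v} → D u v → Continuous fun x : K.Cell s => F x.1 := by
      rintro u v rfl h
      have : (fun x : K.Cell {u, v} => F x.1) = fun x => φ u v (x.1.1 v) := by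
        funext x
        obtain ⟨hI, he⟩ := eq_edgePt_of_support_subset (hD.joined u v h) (hD.ne h) x.2
        exact hF2 _ u v h _ hI he
      rw [this]
      exact (hφ u v h).comp (Cell.continuous_coord v)
    rcases hD.total a b ⟨_, hs, by simp [hs'], by simp [hs']⟩ hab with h | h
    · exact main a b hs' h
    · exact main b a (hs'.trans (Finset.pair_comm a b)) h

end AbstractSimplicialComplex

/-! ### Points and topology of a wedge of circles -/

namespace WedgeOfCircles

variable {J : Type u}

/-- The wedge point. -/
def base (J : Type u) : WedgeOfCircles J := Quot.mk _ (Sum.inl PUnit.unit)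

/-- The inclusion of a circle. -/
def incl (j : J) (z : Circle) : WedgeOfCircles J := Quot.mk _ (Sum.inr ⟨j, z⟩)

theorem continuous_incl (j : J) : Continuous (incl j) :=
  continuous_quot_mk.comp (continuous_inr.comp continuous_sigmaMk)

theorem incl_one (j : J) : incl j 1 = base J := (Quot.sound (WedgeRel.glue j)).symm

open Classical in
/-- The circle and the point on it of a point other than the wedge point. -/
noncomputable def position : WedgeOfCircles J → Option (Σ _ : J, Circle) :=
  Quot.lift (Sum.elim (fun _ => none) fun a => if a.2 = 1 then none else some a) (by
    rintro _ _ ⟨j⟩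
    simp)

theorem position_base : position (base J) = none := rfl

theorem position_incl {j : J} {z : Circle} (hz : z ≠ 1) : position (incl j z) = some ⟨j, z⟩ :=
  if_neg hz

theorem incl_ne_base {j : J} {z : Circle} (hz : z ≠ 1) : incl j z ≠ base J := fun h => by
  have := congrArg position h
  rw [position_incl hz, position_base] at this
  exact Option.some_ne_none _ this

theorem incl_inj {j k : J} {z w : Circle} (hz : z ≠ 1) (hw : w ≠ 1) (h : incl j z = incl k w) :
    j = k ∧ z = w := by
  have := congrArg position h
  rw [position_incl hz, position_incl hw] at this
  simpa using this

theorem cases (w : WedgeOfCircles J) : w = base J ∨ ∃ j z, w = incl j z := by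
  induction w using Quot.ind with
  | mk a =>
    rcases a with ⟨⟩ | ⟨j, z⟩
    · exact Or.inl rfl
    · exact Or.inr ⟨j, z, rfl⟩

theorem isOpen_of_incl {U : Set (WedgeOfCircles J)} (h : ∀ j, IsOpen (incl j ⁻¹' U)) :
    IsOpen U := by
  change IsOpen (Quot.mk (WedgeRel _ _) ⁻¹' U)
  rw [isOpen_sum_iff, isOpen_sigma_iff]
  exact ⟨isOpen_discrete _, h⟩

end WedgeOfCircles

/-- The parametrization of the circle by the unit interval. -/
noncomputable def Circle.wrap (s : ℝ) : Circle := Circle.exp (2 * Real.pi * s)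

namespace Circle

theorem continuous_wrap : Continuous wrap := Circle.exp.continuous.comp (by fun_prop)

theorem wrap_zero : wrap 0 = 1 := by simp [wrap]

theorem wrap_one : wrap 1 = 1 := by simp [wrap]

theorem wrap_injOn : Set.InjOn wrap (Set.Ico 0 1) := by
  intro s hs t ht h
  have hpi := Real.pi_pos
  have := Circle.exp_injOn_Ico (a := 0) (b := 2 * Real.pi) (by linarith)
    ⟨by have := hs.1; positivity, by nlinarith [hs.2]⟩
    ⟨by have := ht.1; positivity, by nlinarith [ht.2]⟩ h
  exact mul_left_cancel₀ (by positivity) this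

theorem wrap_ne_one {s : ℝ} (hs : s ∈ Set.Ioo (0 : ℝ) 1) : wrap s ≠ 1 := fun h =>
  hs.1.ne' (wrap_injOn ⟨hs.1.le, hs.2⟩ ⟨le_rfl, zero_lt_one⟩ (h.trans wrap_zero.symm))

/-- A continuous surjection from a compact space to a Hausdorff space is closed, hence a quotient
map. -/
theorem isQuotientMap_wrap : Topology.IsQuotientMap fun s : I => wrap s := by
  have hc : Continuous fun s : I => wrap s := continuous_wrap.comp continuous_subtype_val
  refine hc.isClosedMap.isQuotientMap hc fun z => ?_
  have hpi := Real.pi_pos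
  have h1 := Complex.neg_pi_lt_arg (z : ℂ)
  have h2 := Complex.arg_le_pi (z : ℂ)
  -- The argument lies in $(-\pi, \pi]$; negative values are shifted by $2\pi$ to give a parameter
  -- in $[0, 1]$.
  rcases le_or_gt 0 (Complex.arg (z : ℂ)) with h | h
  · refine ⟨⟨Complex.arg z / (2 * Real.pi), by positivity, ?_⟩, ?_⟩
    · rw [div_le_one (by positivity)]
      linarith
    · change Circle.exp _ = z
      rw [mul_div_cancel₀ _ (by positivity), Circle.exp_arg]
  · refine ⟨⟨(Complex.arg z + 2 * Real.pi) / (2 * Real.pi),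
      div_nonneg (by linarith) (by positivity), ?_⟩, ?_⟩
    · rw [div_le_one (by positivity)]
      linarith
    · change Circle.exp _ = z
      rw [mul_div_cancel₀ _ (by positivity), Circle.exp_add_two_pi, Circle.exp_arg]

end Circle

/-! ### Spanning trees and their contraction -/

namespace AbstractSimplicialComplex

variable {W : Type u} {K : AbstractSimplicialComplex W}

/-- A rooted spanning tree, given by the parent of each vertex. -/
structure SpanningTree (K : AbstractSimplicialComplex W) where
  root : W
  parent : W → W
  depth : W → ℕ
  eq_root_of_depth : ∀ v, depth v = 0 → v = root
  depth_root : depth root = 0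
  joined : ∀ v, K.Joined (parent v) v
  depth_parent : ∀ v, v ≠ root → depth v = depth (parent v) + 1

/-- The parent is the next vertex on a shortest walk to a fixed root, and the root is its own
parent. -/
theorem nonempty_spanningTree (h : K.skeletonGraph.Connected) : Nonempty (SpanningTree K) := by
  obtain ⟨o⟩ := h.nonempty
  have key : ∀ v, ∃ u, K.Joined u v ∧
      (v ≠ o → K.skeletonGraph.dist v o = K.skeletonGraph.dist u o + 1) := by
    intro v
    obtain ⟨w, hw⟩ := h.exists_walk_length_eq_dist v o
    cases w with
    | nil => exact ⟨_, joined_self _, fun hv => (hv rfl).elim⟩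
    | @cons _ u _ hadj p =>
      refine ⟨u, hadj.symm.2, fun _ => ?_⟩
      have h1 := SimpleGraph.dist_le p
      have h2 := h.dist_triangle (u := v) (v := u) (w := o)
      rw [SimpleGraph.dist_eq_one_iff_adj.2 hadj] at h2
      rw [SimpleGraph.Walk.length_cons] at hw
      omega
  choose par hp1 hp2 using key
  exact ⟨⟨o, par, fun v => K.skeletonGraph.dist v o,
    fun v hv => (h.dist_eq_zero_iff).1 hv, SimpleGraph.dist_self, hp1, hp2⟩⟩

namespace SpanningTree

open Realization WedgeOfCircles

variable (T : SpanningTree K)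

/-- The path in the tree from the root to a vertex `v` of depth `n`, parametrized by the depth. -/
noncomputable def pathAux : ℕ → W → ℝ → K.Realization
  | 0, v, _ => vert K v
  | n + 1, v, x => if x ≤ n then pathAux n (T.parent v) x else edgePt (T.joined v) (x - n)

/-- The path in the tree from the root to a vertex, parametrized by the depth. -/
noncomputable def path (v : W) : ℝ → K.Realization := T.pathAux (T.depth v) v

theorem pathAux_of_le {n : ℕ} (v : W) {x : ℝ} (hx : n ≤ x) : T.pathAux n v x = vert K v := by
  cases n with
  | zero => rfl
  | succ n =>
    push_cast at hx
    rw [pathAux, if_neg (by linarith), edgePt_of_one_le _ (by linarith)]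

theorem continuous_pathAux (n : ℕ) (v : W) : Continuous (T.pathAux n v) := by
  induction n generalizing v with
  | zero => exact continuous_const
  | succ n ih =>
    refine Continuous.if_le (ih _) ((continuous_edgePt _).comp (by fun_prop)) continuous_id
      continuous_const fun x hx => ?_
    rw [T.pathAux_of_le _ hx.ge, hx, sub_self, edgePt_zero]

theorem continuous_path (v : W) : Continuous (T.path v) := T.continuous_pathAux _ v

theorem path_depth (v : W) : T.path v (T.depth v) = vert K v := T.pathAux_of_le v le_rfl

/-- The tree paths are nested; this is why the contraction formulas on the edges agree at common
vertices. -/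
theorem path_parent {v : W} (hv : v ≠ T.root) {x : ℝ} (hx : x ≤ T.depth (T.parent v)) :
    T.path v x = T.path (T.parent v) x := by
  rw [path, T.depth_parent v hv, pathAux, if_pos hx, path]

theorem path_edge {v : W} (hv : v ≠ T.root) {s : ℝ} (hs : 0 < s) :
    T.path v (T.depth (T.parent v) + s) = edgePt (T.joined v) s := by
  rw [path, T.depth_parent v hv, pathAux, if_neg (by linarith), add_sub_cancel_left]

theorem path_induction {P : K.Realization → Prop} (hP : ∀ v, P (vert K v))
    (hP' : ∀ v, v ≠ T.root → ∀ s ∈ I, P (edgePt (T.joined v) s)) (v : W) (x : ℝ) :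
    P (T.path v x) := by
  induction hn : T.depth v generalizing v x with
  | zero =>
    rw [path, hn]
    exact hP v
  | succ n ih =>
    have hv : v ≠ T.root := fun e => by rw [e, T.depth_root] at hn; omega
    have hd := T.depth_parent v hv
    rcases le_or_gt x (T.depth (T.parent v)) with hx | hx
    · rw [T.path_parent hv hx]
      exact ih _ _ (by omega)
    · obtain ⟨s, rfl⟩ : ∃ s, x = T.depth (T.parent v) + s := ⟨x - T.depth (T.parent v), by ring⟩
      have hs : 0 < s := by linarith
      rw [T.path_edge hv hs]
      rcases le_total s 1 with h1 | h1
      · exact hP' v hv s ⟨hs.le, h1⟩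
      · rw [edgePt_of_one_le _ h1]
        exact hP v

theorem path_zero (v : W) : T.path v 0 = vert K T.root := by
  induction hn : T.depth v generalizing v with
  | zero =>
    rw [path, hn, T.eq_root_of_depth v hn]
    rfl
  | succ n ih =>
    have hv : v ≠ T.root := fun e => by rw [e, T.depth_root] at hn; omega
    have hd := T.depth_parent v hv
    rw [T.path_parent hv (Nat.cast_nonneg _)]
    exact ih _ (by omega)

/-- The oriented edges outside of the tree. -/
def Chord (u v : W) : Prop :=
  K.Joined u v ∧ u ≠ v ∧ ¬ (v ≠ T.root ∧ u = T.parent v) ∧ ¬ (u ≠ T.root ∧ v = T.parent u) ∧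
    WellOrderingRel u v

/-- The edges, with tree edges oriented away from the root. -/
def Edge (u v : W) : Prop := (v ≠ T.root ∧ u = T.parent v) ∨ T.Chord u v

/-- Two tree edges cannot be opposite because depth increases along them; chords are directed by a
well-order. -/
theorem isOrientation : IsOrientation K T.Edge where
  joined := by
    rintro u v (⟨_, rfl⟩ | h)
    · exact T.joined v
    · exact h.1
  asymm := by
    rintro u v (⟨hv, rfl⟩ | h) (⟨hu, e⟩ | h')
    · have h1 := T.depth_parent _ hv
      have h2 := T.depth_parent _ hu
      rw [← e] at h2
      omega
    · exact h'.2.2.2.1 ⟨hv, rfl⟩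
    · exact h.2.2.2.1 ⟨hu, e⟩
    · exact asymm h.2.2.2.2 h'.2.2.2.2
  total := by
    intro u v hj hne
    have hj' : K.Joined v u := let ⟨s, hs, h1, h2⟩ := hj; ⟨s, hs, h2, h1⟩
    by_cases h1 : v ≠ T.root ∧ u = T.parent v
    · exact Or.inl (Or.inl h1)
    by_cases h2 : u ≠ T.root ∧ v = T.parent u
    · exact Or.inr (Or.inl h2)
    rcases trichotomous_of WellOrderingRel u v with h | h | h
    · exact Or.inl (Or.inr ⟨hj, hne, h1, h2, h⟩)
    · exact (hne h).elim
    · exact Or.inr (Or.inr ⟨hj', hne.symm, h2, h1, h⟩)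

/-- The loop from the root to a vertex `u`, along an edge `uv` and back, where the parameter is
negative on the first part, in `[0, 1]` on the second and greater than `1` on the third one. -/
noncomputable def loop {u v : W} (h : K.Joined u v) (x : ℝ) : K.Realization :=
  open Classical in
  if x ≤ 0 then T.path u ((1 + x) * T.depth u) else
    if x ≤ 1 then edgePt h x else T.path v ((2 - x) * T.depth v)

theorem continuous_loop {u v : W} (h : K.Joined u v) : Continuous (T.loop h) := by
  refine Continuous.if_le ((T.continuous_path u).comp (by fun_prop)) (Continuous.if_le
    (continuous_edgePt h) ((T.continuous_path v).comp (by fun_prop)) continuous_id continuous_const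
    fun x hx => ?_) continuous_id continuous_const fun x hx => ?_
  · subst hx
    norm_num [edgePt_one, path_depth]
  · subst hx
    norm_num [edgePt_zero, path_depth]

/-- The index set of the chords. -/
abbrev Chords : Type u := {e : W × W // T.Chord e.1 e.2}

/-- The quotient map that collapses the tree. -/
theorem exists_collapse (hdim : ∀ s ∈ K.faces, s.card ≤ 2) :
    ∃ f : C(K.Realization, WedgeOfCircles T.Chords), (∀ v, f (vert K v) = base _) ∧
      (∀ v, v ≠ T.root → ∀ s ∈ I, f (edgePt (T.joined v) s) = base _) ∧
      ∀ u v, ∀ h : T.Chord u v, ∀ s ∈ I,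
        f (edgePt h.1 s) = incl ⟨(u, v), h⟩ (Circle.wrap s) := by
  classical
  obtain ⟨f, hf1, hf2⟩ := T.isOrientation.exists_lift hdim (fun _ => base T.Chords)
    (fun u v s => if h : T.Chord u v then incl ⟨(u, v), h⟩ (Circle.wrap s) else base _)
    (fun u v _ => by
      split_ifs with h
      · exact (continuous_incl _).comp Circle.continuous_wrap
      · exact continuous_const)
    (fun u v _ => by
      split_ifs with h
      · rw [Circle.wrap_zero, incl_one]
      · rfl)
    (fun u v _ => by
      split_ifs with h
      · rw [Circle.wrap_one, incl_one]
      · rfl)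
  refine ⟨f, hf1, fun v hv s hs => ?_, fun u v h s hs => ?_⟩
  · exact (hf2 (T.parent v) v (Or.inl ⟨hv, rfl⟩) s hs).trans
      (dif_neg fun h => h.2.2.1 ⟨hv, rfl⟩)
  · exact (hf2 u v (Or.inr h) s hs).trans (dif_pos h)

/-- The homotopy that contracts the tree to its root. -/
theorem exists_contraction (hdim : ∀ s ∈ K.faces, s.card ≤ 2) :
    ∃ H : C(K.Realization, C(I, K.Realization)),
      (∀ v, ∀ t : I, H (vert K v) t = T.path v ((1 - t) * T.depth v)) ∧
      (∀ v, v ≠ T.root → ∀ s ∈ I, ∀ t : I, H (edgePt (T.joined v) s) t =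
        T.path v ((1 - t) * (T.depth (T.parent v) + s))) ∧
      ∀ u v, ∀ h : T.Chord u v, ∀ s ∈ I, ∀ t : I,
        H (edgePt h.1 s) t = T.loop h.1 (s * (1 + 2 * t) - t) := by
  classical
  let c : W → C(I, K.Realization) := fun v =>
    ⟨fun t => T.path v ((1 - t) * T.depth v), (T.continuous_path v).comp (by fun_prop)⟩
  -- A point of the tree at depth $d$ slides towards the root to depth $(1 - t)d$.
  let φ₁ : W → W → ℝ → C(I, K.Realization) := fun u v s =>
    ⟨fun t => T.path v ((1 - t) * (T.depth u + s)), (T.continuous_path v).comp (by fun_prop)⟩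
  -- At time $t$ the chord is stretched affinely over the parameters $[-t, 1 + t]$ of the loop: the
  -- chord itself at $t = 0$, the full loop at $t = 1$. Its ends thus follow the moving endpoints.
  let φ₂ : ∀ u v, T.Chord u v → ℝ → C(I, K.Realization) := fun u v h s =>
    ⟨fun t => T.loop h.1 (s * (1 + 2 * t) - t), (T.continuous_loop h.1).comp (by fun_prop)⟩
  have htree : ∀ {u v}, T.Edge u v → ¬ T.Chord u v → v ≠ T.root ∧ u = T.parent v :=
    fun h h' => h.resolve_right h'
  obtain ⟨H, hH1, hH2⟩ := T.isOrientation.exists_lift hdim c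
    (fun u v s => if h : T.Chord u v then φ₂ u v h s else φ₁ u v s)
    (fun u v _ => by
      split_ifs with h
      · refine ContinuousMap.continuous_of_continuous_uncurry _ ?_
        exact (T.continuous_loop h.1).comp (f := fun a : ℝ × I => a.1 * (1 + 2 * a.2) - a.2)
          (by fun_prop)
      · refine ContinuousMap.continuous_of_continuous_uncurry _ ?_
        exact (T.continuous_path v).comp (f := fun a : ℝ × I => (1 - (a.2 : ℝ)) * ((T.depth u : ℝ) + a.1))
          (by fun_prop))
    (fun u v hE => by
      split_ifs with h
      · ext1 t
        have ht := t.2.1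
        simp only [φ₂, c, ContinuousMap.coe_mk, loop]
        rw [if_pos (by linarith)]
        ring_nf
      · obtain ⟨hv, rfl⟩ := htree hE h
        ext1 t
        simp only [φ₁, c, ContinuousMap.coe_mk, add_zero]
        refine T.path_parent hv (mul_le_of_le_one_left (Nat.cast_nonneg _) ?_)
        linarith [t.2.1])
    (fun u v hE => by
      split_ifs with h
      · ext1 t
        have ht := t.2.1
        simp only [φ₂, c, ContinuousMap.coe_mk, loop]
        rw [if_neg (by linarith)]
        rcases ht.eq_or_lt with h0 | h0
        · rw [← h0]
          norm_num [edgePt_one, path_depth]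
        · rw [if_neg (by linarith)]
          ring_nf
      · obtain ⟨hv, rfl⟩ := htree hE h
        ext1 t
        simp only [φ₁, c, ContinuousMap.coe_mk, T.depth_parent v hv, Nat.cast_add, Nat.cast_one])
  refine ⟨H, fun v t => ?_, fun v hv s hs t => ?_, fun u v h s hs t => ?_⟩
  · rw [hH1]
    rfl
  · refine (DFunLike.congr_fun (hH2 (T.parent v) v (Or.inl ⟨hv, rfl⟩) s hs) t).trans ?_
    rw [dif_neg fun h => h.2.2.1 ⟨hv, rfl⟩]
    rfl
  · refine (DFunLike.congr_fun (hH2 u v (Or.inr h) s hs) t).trans ?_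
    rw [dif_pos h]
    rfl

theorem cases (hdim : ∀ s ∈ K.faces, s.card ≤ 2) (x : K.Realization) : (∃ v, x = vert K v) ∨
    (∃ v, v ≠ T.root ∧ ∃ s ∈ Set.Ioo (0 : ℝ) 1, x = edgePt (T.joined v) s) ∨
    ∃ u v, ∃ h : T.Chord u v, ∃ s ∈ Set.Ioo (0 : ℝ) 1, x = edgePt h.1 s := by
  rcases T.isOrientation.cases hdim x with hv | ⟨u, v, ⟨hv, rfl⟩ | h, s, hs, hx⟩
  · exact Or.inl hv
  · exact Or.inr (Or.inl ⟨v, hv, s, hs, hx⟩)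
  · exact Or.inr (Or.inr ⟨u, v, h, s, hs, hx⟩)

/-- The only fibre of the collapse with several points is the tree. The contraction keeps the tree
inside itself and ends at the root, so it is compatible with the collapse. -/
theorem nonempty_homotopyEquiv (hdim : ∀ s ∈ K.faces, s.card ≤ 2) :
    Nonempty (ContinuousMap.HomotopyEquiv K.Realization (WedgeOfCircles T.Chords)) := by
  obtain ⟨f, hfv, hft, hfc⟩ := T.exists_collapse hdim
  obtain ⟨H, hHv, hHt, hHc⟩ := T.exists_contraction hdim
  have hI : Set.Ioo (0 : ℝ) 1 ⊆ I := Set.Ioo_subset_Icc_self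
  have hfpath : ∀ v x, f (T.path v x) = base _ := 
    T.path_induction (P := fun x => f x = base _) hfv hft
  have hbase : ∀ x, f x = base _ → H x 1 = vert K T.root ∧ ∀ t, f (H x t) = base _ := by
    intro x hx
    rcases T.cases hdim x with ⟨v, rfl⟩ | ⟨v, hv, s, hs, rfl⟩ | ⟨u, v, h, s, hs, rfl⟩
    · refine ⟨?_, fun t => ?_⟩
      · simp [hHv, path_zero]
      · rw [hHv, hfpath]
    · refine ⟨?_, fun t => ?_⟩
      · simp [hHt v hv s (hI hs), path_zero]
      · rw [hHt v hv s (hI hs), hfpath]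
    · rw [hfc u v h s (hI hs)] at hx
      exact (incl_ne_base (Circle.wrap_ne_one hs) hx).elim
  have hinj : ∀ x y, f x = f y → x = y ∨ (f x = base _ ∧ f y = base _) := by
    intro x y hxy
    by_cases hx : f x = base _
    · exact Or.inr ⟨hx, hxy ▸ hx⟩
    have hy : f y ≠ base _ := hxy ▸ hx
    have hform : ∀ x, f x ≠ base _ → ∃ u v, ∃ h : T.Chord u v, ∃ s ∈ Set.Ioo (0 : ℝ) 1,
        x = edgePt h.1 s := by
      intro x hx
      rcases T.cases hdim x with ⟨v, rfl⟩ | ⟨v, hv, s, hs, rfl⟩ | h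
      · exact (hx (hfv v)).elim
      · exact (hx (hft v hv s (hI hs))).elim
      · exact h
    obtain ⟨u, v, h, s, hs, rfl⟩ := hform x hx
    obtain ⟨u', v', h', s', hs', rfl⟩ := hform y hy
    rw [hfc u v h s (hI hs), hfc u' v' h' s' (hI hs')] at hxy
    obtain ⟨he, hz⟩ := incl_inj (Circle.wrap_ne_one hs) (Circle.wrap_ne_one hs') hxy
    obtain ⟨rfl, rfl⟩ := Prod.mk.inj (congrArg Subtype.val he)
    rw [Circle.wrap_injOn ⟨hs.1.le, hs.2⟩ ⟨hs'.1.le, hs'.2⟩ hz]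
    exact Or.inl rfl
  have hquot : Topology.IsQuotientMap f := by
    refine (Topology.isQuotientMap_iff _).2 ⟨Topology.isCoinducing_iff.2 fun U =>
      ⟨fun hU => ?_, fun hU => hU.preimage f.continuous⟩, fun w => ?_⟩
    · refine isOpen_of_incl ?_
      rintro ⟨⟨u, v⟩, h⟩
      rw [← Circle.isQuotientMap_wrap.isOpen_preimage]
      have : (fun s : I => Circle.wrap s) ⁻¹' (incl ⟨(u, v), h⟩ ⁻¹' U) =
          (fun s : I => edgePt h.1 s) ⁻¹' (f ⁻¹' U) := by
        ext s
        simp only [Set.mem_preimage, hfc u v h s s.2]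
      rw [this]
      exact hU.preimage ((continuous_edgePt h.1).comp continuous_subtype_val)
    · rcases WedgeOfCircles.cases w with rfl | ⟨⟨⟨u, v⟩, h⟩, z, rfl⟩
      · exact ⟨vert K T.root, hfv _⟩
      · obtain ⟨s, rfl⟩ := Circle.isQuotientMap_wrap.surjective z
        exact ⟨edgePt h.1 s, hfc u v h s s.2⟩
  refine hquot.nonempty_homotopyEquiv H (fun x => ?_) (fun x y hxy => ?_) fun x y hxy t => ?_
  · rcases T.cases hdim x with ⟨v, rfl⟩ | ⟨v, hv, s, hs, rfl⟩ | ⟨u, v, h, s, hs, rfl⟩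
    · simp [hHv, path_depth]
    · simp [hHt v hv s (hI hs), T.path_edge hv hs.1]
    · rw [hHc u v h s (hI hs), loop]
      have h1 := hs.1
      have h2 := hs.2
      simp [h1.not_ge, h2.le]
  · rcases hinj x y hxy with rfl | ⟨hx, hy⟩
    · rfl
    · rw [(hbase x hx).1, (hbase y hy).1]
  · rcases hinj x y hxy with rfl | ⟨hx, hy⟩
    · rfl
    · rw [(hbase x hx).2, (hbase y hy).2]

end SpanningTree

/-- A connected one-dimensional complex is homotopy equivalent to a wedge of circles. -/
theorem exists_homotopyEquiv_wedgeOfCircles (hconn : K.skeletonGraph.Connected)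
    (hdim : ∀ s ∈ K.faces, s.card ≤ 2) : ∃ J : Type u,
      Nonempty (ContinuousMap.HomotopyEquiv K.Realization (WedgeOfCircles J)) := by
  obtain ⟨T⟩ := nonempty_spanningTree hconn
  exact ⟨T.Chords, T.nonempty_homotopyEquiv hdim⟩

end AbstractSimplicialComplex

/-! ### Removing free pairs from a complex -/

namespace AbstractSimplicialComplex

variable {W : Type u}

/-- The faces that contain none of the given pairs of vertices. -/
def deletePairs (K : AbstractSimplicialComplex W) {ι : Type*} (p q : ι → W) (h : ∀ i, p i ≠ q i) :
    AbstractSimplicialComplex W where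
  faces := {s | s ∈ K.faces ∧ ∀ i, ¬ (p i ∈ s ∧ q i ∈ s)}
  isRelLowerSet_faces := fun _ hs => ⟨(K.isRelLowerSet_faces hs.1).1, fun _ hts ht =>
    ⟨mem_faces_of_subset hs.1 hts ht, fun i hi => hs.2 i ⟨hts hi.1, hts hi.2⟩⟩⟩
  singleton_mem := fun v => ⟨K.singleton_mem v, fun i hi => h i
    ((Finset.mem_singleton.1 hi.1).trans (Finset.mem_singleton.1 hi.2).symm)⟩

end AbstractSimplicialComplex

/-! ### Stars and triangles in a subcubic graph -/

namespace SimpleGraph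

variable {V : Type u} {G : SimpleGraph V}

theorem edge_ext {e f : G.edgeSet} {v w : V} (hvw : v ≠ w) (h1 : v ∈ e.1) (h2 : w ∈ e.1)
    (h3 : v ∈ f.1) (h4 : w ∈ f.1) : e = f :=
  Subtype.ext (((Sym2.mem_and_mem_iff hvw).1 ⟨h1, h2⟩).trans
    ((Sym2.mem_and_mem_iff hvw).1 ⟨h3, h4⟩).symm)

theorem exists_other {e : G.edgeSet} {v : V} (h : v ∈ e.1) :
    ∃ w, G.Adj v w ∧ e.1 = s(v, w) := by
  obtain ⟨w, hw⟩ := h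
  refine ⟨w, ?_, hw⟩
  rw [← mem_edgeSet, ← hw]
  exact e.2

theorem neighborSet_eq_of_adj {v x y z : V} (hdeg : (G.neighborSet v).encard ≤ 3)
    (hx : G.Adj v x) (hy : G.Adj v y) (hz : G.Adj v z) (hxy : x ≠ y) (hxz : x ≠ z) (hyz : y ≠ z) :
    G.neighborSet v = {x, y, z} := by
  symm
  refine Set.Finite.eq_of_subset_of_encard_le (Set.toFinite _) ?_ ?_
  · rintro w (rfl | rfl | rfl) <;> assumption
  · rwa [Set.encard_eq_three.2 ⟨x, y, z, hxy, hxz, hyz, rfl⟩]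

/-- A connected graph in which four pairwise adjacent vertices have no other neighbors is
complete on four vertices. -/
theorem nonempty_iso_top_four (hconn : G.Connected) (hdeg : ∀ v : V, (G.neighborSet v).encard ≤ 3)
    {v x y z : V} (hvx : G.Adj v x) (hvy : G.Adj v y) (hvz : G.Adj v z) (hxy : G.Adj x y)
    (hxz : G.Adj x z) (hyz : G.Adj y z) : Nonempty (G ≃g (⊤ : SimpleGraph (Fin 4))) := by
  have hN : ∀ {a b c d : V}, G.Adj a b → G.Adj a c → G.Adj a d → b ≠ c → b ≠ d → c ≠ d →
      ∀ w, G.Adj a w → w = b ∨ w = c ∨ w = d := by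
    intro a b c d h1 h2 h3 h4 h5 h6 w hw
    rwa [← mem_neighborSet, neighborSet_eq_of_adj (hdeg a) h1 h2 h3 h4 h5 h6] at hw
  let f : Fin 4 → V := ![v, x, y, z]
  have hadj : ∀ i j, i ≠ j → G.Adj (f i) (f j) := by
    intro i j hij
    fin_cases i <;> fin_cases j <;>
      first | exact (hij rfl).elim | assumption | (apply SimpleGraph.Adj.symm; assumption)
  have hinj : Function.Injective f := fun i j h => by_contra fun hij => (hadj i j hij).ne h
  -- Each of the four vertices already has three neighbours among them, so no walk leaves the set.
  have hclosed : ∀ i w, G.Adj (f i) w → w ∈ Set.range f := by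
    intro i w hw
    have : w = v ∨ w = x ∨ w = y ∨ w = z := by
      fin_cases i
      · rcases hN hvx hvy hvz hxy.ne hxz.ne hyz.ne w hw with h | h | h <;> simp [h]
      · rcases hN hvx.symm hxy hxz hvy.ne hvz.ne hyz.ne w hw with h | h | h <;> simp [h]
      · rcases hN hvy.symm hxy.symm hyz hvx.ne hvz.ne hxz.ne w hw with h | h | h <;> simp [h]
      · rcases hN hvz.symm hxz.symm hyz.symm hvx.ne hvy.ne hxy.ne w hw with h | h | h <;> simp [h]
    rcases this with rfl | rfl | rfl | rfl
    exacts [⟨0, rfl⟩, ⟨1, rfl⟩, ⟨2, rfl⟩, ⟨3, rfl⟩]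
  have hwalk : ∀ a b, G.Walk a b → a ∈ Set.range f → b ∈ Set.range f := by
    intro a b w
    induction w with
    | nil => exact id
    | cons h _ ih =>
      rintro ⟨i, rfl⟩
      exact ih (hclosed i _ h)
  have hsurj : Function.Surjective f := fun w => by
    obtain ⟨p⟩ := hconn.preconnected v w
    exact hwalk _ _ p ⟨0, rfl⟩
  refine ⟨RelIso.symm ⟨Equiv.ofBijective f ⟨hinj, hsurj⟩, ?_⟩⟩
  intro i j
  rw [top_adj]
  exact ⟨fun h hij => h.ne (congrArg f hij), hadj i j⟩

/-- Three distinct edges at a vertex of a subcubic graph are all edges at this vertex. -/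
theorem star_eq_of_mem (hdeg : ∀ v : V, (G.neighborSet v).encard ≤ 3) {v : V} {e f g : G.edgeSet}
    (hef : e ≠ f) (heg : e ≠ g) (hfg : f ≠ g) (he : v ∈ e.1) (hf : v ∈ f.1) (hg : v ∈ g.1) :
    (G.neighborSet v).encard = 3 ∧ ∀ d : G.edgeSet, v ∈ d.1 → d = e ∨ d = f ∨ d = g := by
  obtain ⟨x, hx, hex⟩ := exists_other he
  obtain ⟨y, hy, hfy⟩ := exists_other hf
  obtain ⟨z, hz, hgz⟩ := exists_other hg
  have hxy : x ≠ y := fun h => hef (Subtype.ext (by rw [hex, hfy, h]))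
  have hxz : x ≠ z := fun h => heg (Subtype.ext (by rw [hex, hgz, h]))
  have hyz : y ≠ z := fun h => hfg (Subtype.ext (by rw [hfy, hgz, h]))
  have hN := neighborSet_eq_of_adj (hdeg v) hx hy hz hxy hxz hyz
  refine ⟨Set.encard_eq_three.2 ⟨x, y, z, hxy, hxz, hyz, hN⟩, fun d hd => ?_⟩
  obtain ⟨w, hw, hdw⟩ := exists_other hd
  have : w ∈ ({x, y, z} : Set V) := hN ▸ hw
  rcases this with rfl | rfl | rfl
  · exact Or.inl (Subtype.ext (hdw.trans hex.symm))
  · exact Or.inr (Or.inl (Subtype.ext (hdw.trans hfy.symm)))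
  · exact Or.inr (Or.inr (Subtype.ext (hdw.trans hgz.symm)))

/-- Two edges have a common endpoint. -/
def Meet (e f : G.edgeSet) : Prop := ∃ v, v ∈ e.1 ∧ v ∈ f.1

theorem Meet.symm {e f : G.edgeSet} (h : Meet e f) : Meet f e := let ⟨v, h1, h2⟩ := h; ⟨v, h2, h1⟩

theorem meet_of_mem_faces {s : Finset G.edgeSet} (hs : s ∈ G.lineGraph.cliqueComplex.faces)
    {e f : G.edgeSet} (he : e ∈ s) (hf : f ∈ s) : Meet e f := by
  by_cases h : e = f
  · subst h
    obtain ⟨e, h⟩ := e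
    induction e with
    | _ x y => exact ⟨x, by simp, by simp⟩
  · exact (lineGraph_adj_iff_exists.1 (hs.2 he hf h)).2

theorem mem_faces_of_meet {s : Finset G.edgeSet} (hs : s.Nonempty)
    (h : ∀ e ∈ s, ∀ f ∈ s, Meet e f) : s ∈ G.lineGraph.cliqueComplex.faces :=
  ⟨hs, fun e he f hf hne => lineGraph_adj_iff_exists.2 ⟨hne, h e he f hf⟩⟩

/-- The edges `p`, `q`, `r` at a vertex `v` of degree three, where no edge joins the other
endpoints of `p` and `q`. -/
structure IsFreeStar (v : V) (p q r : G.edgeSet) : Prop where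
  ne_pq : p ≠ q
  ne_pr : p ≠ r
  ne_qr : q ≠ r
  mem_p : v ∈ p.1
  mem_q : v ∈ q.1
  mem_r : v ∈ r.1
  eq_of_mem : ∀ w : G.edgeSet, v ∈ w.1 → w = p ∨ w = q ∨ w = r
  not_meet : ∀ w : G.edgeSet, v ∉ w.1 → ¬ (Meet w p ∧ Meet w q)

/-- Three pairwise adjacent neighbours would force $K_4$, so two neighbours $x, y$ of $v$ are
nonadjacent. An edge that avoids $v$ and meets both $vx$ and $vy$ would have to be $xy$. -/
theorem exists_isFreeStar (hconn : G.Connected) (hdeg : ∀ v : V, (G.neighborSet v).encard ≤ 3)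
    (hK4 : IsEmpty (G ≃g (⊤ : SimpleGraph (Fin 4)))) {v : V}
    (hv : (G.neighborSet v).encard = 3) : ∃ p q r : G.edgeSet, IsFreeStar v p q r := by
  have main : ∀ x y z, x ≠ y → x ≠ z → y ≠ z → G.Adj v x → G.Adj v y → G.Adj v z →
      ¬ G.Adj x y → ∃ p q r : G.edgeSet, IsFreeStar v p q r := by
    intro x y z hxy hxz hyz hx hy hz hn
    have key : ∀ {a b : V}, a ≠ b → s(v, a) ≠ s(v, b) := fun hab h => hab (Sym2.congr_right.1 h)
    have n1 : (⟨s(v, x), hx⟩ : G.edgeSet) ≠ ⟨s(v, y), hy⟩ := fun h => key hxy (congrArg Subtype.val h)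
    have n2 : (⟨s(v, x), hx⟩ : G.edgeSet) ≠ ⟨s(v, z), hz⟩ := fun h => key hxz (congrArg Subtype.val h)
    have n3 : (⟨s(v, y), hy⟩ : G.edgeSet) ≠ ⟨s(v, z), hz⟩ := fun h => key hyz (congrArg Subtype.val h)
    refine ⟨⟨s(v, x), hx⟩, ⟨s(v, y), hy⟩, ⟨s(v, z), hz⟩, n1, n2, n3, by simp, by simp, by simp,
      (star_eq_of_mem hdeg n1 n2 n3 (by simp) (by simp) (by simp)).2, ?_⟩
    rintro w hw ⟨⟨a, ha, ha'⟩, b, hb, hb'⟩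
    have hax : a = x := (Sym2.mem_iff.1 ha').resolve_left fun h => hw (h ▸ ha)
    have hby : b = y := (Sym2.mem_iff.1 hb').resolve_left fun h => hw (h ▸ hb)
    subst hax hby
    have := (Sym2.mem_and_mem_iff hxy).1 ⟨ha, hb⟩
    exact hn (by rw [← mem_edgeSet, ← this]; exact w.2)
  obtain ⟨x, y, z, hxy, hxz, hyz, hN⟩ := Set.encard_eq_three.1 hv
  have hx : G.Adj v x := by rw [← mem_neighborSet, hN]; simp
  have hy : G.Adj v y := by rw [← mem_neighborSet, hN]; simp
  have hz : G.Adj v z := by rw [← mem_neighborSet, hN]; simp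
  by_cases h1 : G.Adj x y
  · by_cases h2 : G.Adj x z
    · by_cases h3 : G.Adj y z
      · exact ((not_nonempty_iff.2 hK4) (nonempty_iso_top_four hconn hdeg hx hy hz h1 h2 h3)).elim
      · exact main y z x hyz hxy.symm hxz.symm hy hz hx h3
    · exact main x z y hxz hxy hyz.symm hx hz hy h2
  · exact main x y z hxy hxz hyz hx hy hz h1

/-- The three edges of a triangle with vertex set `t`. -/
structure IsTriangle (t : Finset V) (p q r : G.edgeSet) : Prop where
  ne_pq : p ≠ q
  ne_pr : p ≠ r
  ne_qr : q ≠ r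
  meet_pq : Meet p q
  meet_pr : Meet p r
  meet_qr : Meet q r
  not_mem : ∀ v, v ∈ p.1 → v ∈ q.1 → v ∉ r.1
  subset_p : ∀ v ∈ p.1, v ∈ t
  subset_q : ∀ v ∈ q.1, v ∈ t
  subset_r : ∀ v ∈ r.1, v ∈ t
  cover : ∀ v ∈ t, v ∈ p.1 ∨ v ∈ q.1

theorem exists_isTriangle {t : Finset V} (ht : G.IsNClique 3 t) :
    ∃ p q r : G.edgeSet, IsTriangle t p q r := by
  classical
  obtain ⟨a, b, c, hab, hac, hbc, rfl⟩ := is3Clique_iff.1 ht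
  have n1 := hab.ne
  have n2 := hac.ne
  have n3 := hbc.ne
  refine ⟨⟨s(a, b), hab⟩, ⟨s(a, c), hac⟩, ⟨s(b, c), hbc⟩, ?_, ?_, ?_, ⟨a, by simp, by simp⟩,
    ⟨b, by simp, by simp⟩, ⟨c, by simp, by simp⟩, ?_, ?_, ?_, ?_, ?_⟩
  · exact fun h => absurd (congrArg Subtype.val h) (by simp [n2, n3, n1.symm])
  · exact fun h => absurd (congrArg Subtype.val h) (by simp [n1, n2, n3])
  · exact fun h => absurd (congrArg Subtype.val h) (by simp [n1, n2])
  all_goals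
    intro v
    simp only [Sym2.mem_iff, Finset.mem_insert, Finset.mem_singleton]
    grind

/-- An edge that meets two edges of a triangle away from their common endpoint is the third. -/
theorem IsTriangle.eq_third {t : Finset V} {p q r : G.edgeSet} (h : IsTriangle t p q r) {a : V}
    (hp : a ∈ p.1) (hq : a ∈ q.1) {w : G.edgeSet} (hw : a ∉ w.1) (hwp : Meet w p)
    (hwq : Meet w q) : w = r := by
  have key : ∀ {e : G.edgeSet} {b c : V}, a ∈ e.1 → b ∈ e.1 → c ∈ e.1 → a ≠ b → a ≠ c → b = c := by
    intro e b c ha hb hc hab hac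
    obtain ⟨x, -, hx⟩ := exists_other ha
    rw [hx, Sym2.mem_iff] at hb hc
    rw [hb.resolve_left hab.symm, hc.resolve_left hac.symm]
  obtain ⟨b, hbw, hbp⟩ := hwp
  obtain ⟨c, hcw, hcq⟩ := hwq
  obtain ⟨b', hbp', hbr⟩ := h.meet_pr
  obtain ⟨c', hcq', hcr⟩ := h.meet_qr
  have har := h.not_mem a hp hq
  have hab : a ≠ b := fun e => hw (e ▸ hbw)
  have hac : a ≠ c := fun e => hw (e ▸ hcw)
  have hab' : a ≠ b' := fun e => har (e ▸ hbr)
  have hac' : a ≠ c' := fun e => har (e ▸ hcr)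
  obtain rfl := key hp hbp hbp' hab hab'
  obtain rfl := key hq hcq hcq' hac hac'
  have hbc : b ≠ c := fun e => h.ne_pq (edge_ext hab hp hbp hq (e ▸ hcq))
  exact edge_ext hbc hbw hcw hbr hcr

theorem lineGraph_reachable {u v : V} (w : G.Walk u v) {e f : G.edgeSet} (he : u ∈ e.1)
    (hf : v ∈ f.1) : G.lineGraph.Reachable e f := by
  have key : ∀ {x : V} {e f : G.edgeSet}, x ∈ e.1 → x ∈ f.1 → G.lineGraph.Reachable e f := by
    intro x e f he hf
    by_cases h : e = f
    · exact h ▸ .refl _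
    · exact (lineGraph_adj_iff_exists.2 ⟨h, x, he, hf⟩).reachable
  induction w generalizing e with
  | nil => exact key he hf
  | @cons a b _ h _ ih =>
    exact (key he (f := ⟨s(a, b), h⟩) (by simp)).trans (ih (by simp) hf)

theorem skeletonGraph_cliqueComplex_connected (hconn : G.Connected) (hedge : G.edgeSet.Nonempty) :
    G.lineGraph.cliqueComplex.skeletonGraph.Connected := by
  classical
  have hle : G.lineGraph ≤ G.lineGraph.cliqueComplex.skeletonGraph := by
    intro e f h
    refine ⟨h.ne, {e, f}, ⟨by simp, ?_⟩, by simp, by simp⟩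
    intro a ha b hb hab
    simp only [Finset.coe_insert, Finset.coe_singleton, Set.mem_insert_iff,
      Set.mem_singleton_iff] at ha hb
    rcases ha with rfl | rfl <;> rcases hb with rfl | rfl
    · exact (hab rfl).elim
    · exact h
    · exact h.symm
    · exact (hab rfl).elim
  have : Nonempty G.edgeSet := hedge.to_subtype
  refine ⟨fun e f => ?_⟩
  obtain ⟨v, hv⟩ : ∃ v, v ∈ e.1 := ⟨_, Sym2.out_fst_mem _⟩
  obtain ⟨w, hw⟩ : ∃ w, w ∈ f.1 := ⟨_, Sym2.out_fst_mem _⟩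
  obtain ⟨p⟩ := hconn.preconnected v w
  exact (lineGraph_reachable p hv hw).mono hle

end SimpleGraph

/-! ### The two rounds of collapses -/

open AbstractSimplicialComplex SimpleGraph in
theorem mainTheorem12 {V : Type u} (G : SimpleGraph V) (hconn : G.Connected)
    (hedge : G.edgeSet.Nonempty)
    (hdeg : ∀ v : V, (G.neighborSet v).encard ≤ 3)
    (hK4 : IsEmpty (G ≃g (⊤ : SimpleGraph (Fin 4)))) :
    ∃ J : Type u, Nonempty (ContinuousMap.HomotopyEquiv
      (G.lineGraph.cliqueComplex).Realization (WedgeOfCircles J)) := by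
  classical
  choose p q r hstar using fun v : {v // (G.neighborSet v).encard = 3} =>
    exists_isFreeStar hconn hdeg hK4 v.2
  choose p' q' r' htri using fun t : {t // G.IsNClique 3 t} => exists_isTriangle t.2
  let K₁ := G.lineGraph.cliqueComplex.deletePairs p q fun v => (hstar v).ne_pq
  let K₂ := K₁.deletePairs p' q' fun t => (htri t).ne_pq
  have hfree : ∀ v, ∀ s ∈ G.lineGraph.cliqueComplex.faces, p v ∈ s → q v ∈ s → ∀ w ∈ s,
      w = p v ∨ w = q v ∨ w = r v := by
    intro v s hs hp hq w hw
    by_cases hv : v.1 ∈ w.1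
    · exact (hstar v).eq_of_mem w hv
    · exact ((hstar v).not_meet w hv ⟨meet_of_mem_faces hs hw hp, meet_of_mem_faces hs hw hq⟩).elim
  have h₁ : IsCollapse G.lineGraph.cliqueComplex K₁ p q r :=
    { ne_pq := fun v => (hstar v).ne_pq
      ne_pr := fun v => (hstar v).ne_pr
      ne_qr := fun v => (hstar v).ne_qr
      face := by
        intro v
        have hv : ∀ e ∈ ({p v, q v, r v} : Finset G.edgeSet), v.1 ∈ e.1 := by
          intro e he
          simp only [Finset.mem_insert, Finset.mem_singleton] at he
          rcases he with rfl | rfl | rfl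
          exacts [(hstar v).mem_p, (hstar v).mem_q, (hstar v).mem_r]
        exact ⟨{p v, q v, r v}, mem_faces_of_meet (by simp) fun e he f hf => ⟨v, hv e he, hv f hf⟩,
          by simp, by simp, by simp⟩
      free := hfree
      inj := by
        intro v w s hs hp hq hp' hq'
        have hv : ∀ e ∈ s, v.1 ∈ e.1 := by
          intro e he
          rcases hfree v s hs hp hq e he with rfl | rfl | rfl
          exacts [(hstar v).mem_p, (hstar v).mem_q, (hstar v).mem_r]
        -- All edges in `s` pass through `v`, so the distinct edges `p w` and `q w` would share both
        -- `v` and `w`.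
        by_contra hvw
        exact (hstar w).ne_pq (edge_ext (fun h => hvw (Subtype.ext h)) (hv _ hp') (hstar w).mem_p
          (hv _ hq') (hstar w).mem_q)
      mem_iff := fun s => Iff.rfl }
  -- Three edges at a vertex make up its whole star, which contains a deleted pair.
  have hthree : ∀ s ∈ K₁.faces, ∀ v, ∀ e ∈ s, ∀ f ∈ s, ∀ g ∈ s, e ≠ f → e ≠ g → f ≠ g →
      v ∈ e.1 → v ∈ f.1 → v ∉ g.1 := by
    intro s hs v e he f hf g hg hef heg hfg hve hvf hvg
    obtain ⟨hd, hall⟩ := star_eq_of_mem hdeg hef heg hfg hve hvf hvg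
    have hmem : ∀ d : G.edgeSet, v ∈ d.1 → d ∈ s := by
      intro d hd
      rcases hall d hd with rfl | rfl | rfl <;> assumption
    exact hs.2 ⟨v, hd⟩ ⟨hmem _ (hstar ⟨v, hd⟩).mem_p, hmem _ (hstar ⟨v, hd⟩).mem_q⟩
  have hfree' : ∀ t, ∀ s ∈ K₁.faces, p' t ∈ s → q' t ∈ s → ∀ w ∈ s,
      w = p' t ∨ w = q' t ∨ w = r' t := by
    intro t s hs hp hq w hw
    by_contra hn
    push Not at hn
    obtain ⟨a, hap, haq⟩ := (htri t).meet_pq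
    have haw := hthree s hs a _ hp _ hq _ hw (htri t).ne_pq hn.1.symm hn.2.1.symm hap haq
    exact hn.2.2 ((htri t).eq_third hap haq haw (meet_of_mem_faces hs.1 hw hp)
      (meet_of_mem_faces hs.1 hw hq))
  have h₂ : IsCollapse K₁ K₂ p' q' r' :=
    { ne_pq := fun t => (htri t).ne_pq
      ne_pr := fun t => (htri t).ne_pr
      ne_qr := fun t => (htri t).ne_qr
      face := by
        intro t
        have ht := htri t
        have hmeet : ∀ e ∈ ({p' t, q' t, r' t} : Finset G.edgeSet),
            ∀ f ∈ ({p' t, q' t, r' t} : Finset G.edgeSet), Meet e f := by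
          have hself : ∀ e : G.edgeSet, Meet e e := fun e =>
            ⟨_, Sym2.out_fst_mem _, Sym2.out_fst_mem _⟩
          intro e he f hf
          simp only [Finset.mem_insert, Finset.mem_singleton] at he hf
          rcases he with rfl | rfl | rfl <;> rcases hf with rfl | rfl | rfl
          exacts [hself _, ht.meet_pq, ht.meet_pr, ht.meet_pq.symm, hself _, ht.meet_qr,
            ht.meet_pr.symm, ht.meet_qr.symm, hself _]
        -- The first round leaves the triangles of $G$ intact: if two sides were the free pair at
        -- `v`, the side avoiding `v` would meet both.
        have hthird : ∀ e ∈ ({p' t, q' t, r' t} : Finset G.edgeSet),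
            ∀ f ∈ ({p' t, q' t, r' t} : Finset G.edgeSet), e ≠ f → ∀ v, v ∈ e.1 → v ∈ f.1 →
            ∃ g ∈ ({p' t, q' t, r' t} : Finset G.edgeSet), v ∉ g.1 := by
          intro e he f hf hne v hve hvf
          by_contra hn
          push Not at hn
          exact ht.not_mem v (hn _ (by simp)) (hn _ (by simp)) (hn _ (by simp))
        refine ⟨{p' t, q' t, r' t}, ⟨mem_faces_of_meet (by simp) hmeet, ?_⟩, by simp, by simp,
          by simp⟩
        rintro v ⟨hp, hq⟩
        obtain ⟨g, hg, hvg⟩ := hthird _ hp _ hq (hstar v).ne_pq v (hstar v).mem_p (hstar v).mem_q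
        exact (hstar v).not_meet g hvg ⟨hmeet g hg _ hp, hmeet g hg _ hq⟩
      free := hfree'
      inj := by
        intro t u s hs hp hq hp' hq'
        -- All edges of `s` are sides of `t`, while two sides of `u` cover its vertices; hence `u`
        -- is contained in `t`, and both have three elements.
        have hsub : ∀ e ∈ s, ∀ v ∈ e.1, v ∈ t.1 := by
          intro e he
          rcases hfree' t s hs hp hq e he with rfl | rfl | rfl
          exacts [(htri t).subset_p, (htri t).subset_q, (htri t).subset_r]
        have hut : u.1 ⊆ t.1 := by
          intro v hv
          rcases (htri u).cover v hv with h | h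
          exacts [hsub _ hp' v h, hsub _ hq' v h]
        refine Subtype.ext (Finset.eq_of_subset_of_card_le hut ?_).symm
        rw [t.2.card_eq, u.2.card_eq]
      mem_iff := fun s => Iff.rfl }
  -- Three edges in a face meet pairwise but have no common vertex, so their meeting points `v`,
  -- `a`, `b` span a triangle of $G$. All its sides lie in `s`, among them a pair deleted in the
  -- second round.
  have hdim : ∀ s ∈ K₂.faces, s.card ≤ 2 := by
    intro s hs
    by_contra hcard
    obtain ⟨e, he, f, hf, g, hg, hef, heg, hfg⟩ := Finset.two_lt_card.1 (not_le.1 hcard)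
    obtain ⟨v, hve, hvf⟩ := meet_of_mem_faces hs.1.1 he hf
    have hvg := hthree s hs.1 v e he f hf g hg hef heg hfg hve hvf
    obtain ⟨a, hae, hag⟩ := meet_of_mem_faces hs.1.1 he hg
    obtain ⟨b, hbf, hbg⟩ := meet_of_mem_faces hs.1.1 hf hg
    have hva : v ≠ a := fun h => hvg (h ▸ hag)
    have hvb : v ≠ b := fun h => hvg (h ▸ hbg)
    have hab : a ≠ b := fun h => hef (edge_ext hva hve hae hvf (h ▸ hbf))
    have hadj : ∀ {d : G.edgeSet} {x y : V}, x ≠ y → x ∈ d.1 → y ∈ d.1 → G.Adj x y := by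
      intro d x y hxy hx hy
      rw [← mem_edgeSet, ← (Sym2.mem_and_mem_iff hxy).1 ⟨hx, hy⟩]
      exact d.2
    have ht : G.IsNClique 3 {v, a, b} := is3Clique_iff.2
      ⟨v, a, b, hadj hva hve hae, hadj hvb hvf hbf, hadj hab hag hbg, rfl⟩
    have hmem : ∀ d : G.edgeSet, (∀ x ∈ d.1, x ∈ ({v, a, b} : Finset V)) → d ∈ s := by
      intro d hd
      obtain ⟨x, hx⟩ : ∃ x, x ∈ d.1 := ⟨_, Sym2.out_fst_mem _⟩
      obtain ⟨y, hxy, hdxy⟩ := exists_other hx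
      have hy : y ∈ d.1 := by rw [hdxy]; simp
      have hx' := hd x hx
      have hy' := hd y hy
      have hne := hxy.ne
      have h1 : v ∈ d.1 → a ∈ d.1 → d ∈ s := fun h h' => edge_ext hva hve hae h h' ▸ he
      have h2 : v ∈ d.1 → b ∈ d.1 → d ∈ s := fun h h' => edge_ext hvb hvf hbf h h' ▸ hf
      have h3 : a ∈ d.1 → b ∈ d.1 → d ∈ s := fun h h' => edge_ext hab hag hbg h h' ▸ hg
      simp only [Finset.mem_insert, Finset.mem_singleton] at hx' hy'
      rcases hx' with rfl | rfl | rfl <;> rcases hy' with rfl | rfl | rfl <;>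
        first | exact (hne rfl).elim | exact h1 ‹_› ‹_› | exact h2 ‹_› ‹_› | exact h3 ‹_› ‹_›
    exact hs.2 ⟨_, ht⟩ ⟨hmem _ (htri ⟨_, ht⟩).subset_p, hmem _ (htri ⟨_, ht⟩).subset_q⟩
  obtain ⟨J, ⟨E⟩⟩ := exists_homotopyEquiv_wedgeOfCircles
    (h₂.connected (h₁.connected (skeletonGraph_cliqueComplex_connected hconn hedge))) hdim
  obtain ⟨E₁⟩ := h₁.nonempty_homotopyEquiv
  obtain ⟨E₂⟩ := h₂.nonempty_homotopyEquiv
  exact ⟨J, ⟨(E₁.trans E₂).trans E⟩⟩
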